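/- Let $n\ge 0$ and let $\eta=(\eta^{ij})$ be an invertible symmetric complex $n\times n$ matrix with inverse $(\eta_{ij})$. Let $\mathrm{Cl}(\eta)$ be the complex Clifford algebra with generators $\gamma^1,\dots,\gamma^n$ and relations $\gamma^i\gamma^j+\gamma^j\gamma^i=2\eta^{ij}$, let $W(2n)$ be the Weyl algebra with generators $x^1,\dots,x^n,\partial_1,\dots,\partial_n$ and relations $[x^i,x^j]=[\partial_i,\partial_j]=0$, $[\partial_i,x^j]=\delta_i^j$, and let $\mathcal A=W(2n)\otimes_{\mathbb C}\mathrm{Cl}(\eta)$ be the Weyl-Clifford algebra. It acts on the space $V=\mathbb C[x^1,\dots,x^n]\otimes\mathrm{Cl}(\eta)$ of Clifford-valued polynomials, $x^i$ and $\gamma^i$ acting by left multiplication and $\partial_i$ by partial differentiation. With summation over repeated indices, put $x_i=\eta_{ij}x^j$, $\partial^i=\eta^{ij}\partial_j$ and $$X=\tfrac{\sqrt{-1}}{\sqrt2}\,\gamma^a\partial_a,\qquad E=-\tfrac12\partial^a\partial_a,\qquad H=-\tfrac12(\partial_a x^a+x^a\partial_a).$$ Let $I=\mathcal A\cdot(\mathbb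 CX\oplus\mathbb CE)$, a left ideal of $\mathcal A$, let $N=\{a\in\mathcal A: Ia\subseteq I\}$ be its normalizer, and let $Z_n=N/I$ be the Dirac reduction algebra. It acts on the space $V^+=\{\varphi\in V:\gamma^a\partial_a\varphi=0\}$ of polynomial solutions of the Dirac equation, through the action of $\mathcal A$ on $V$. For $1\le i\le n$, the element $(H+1)x^i+\tfrac12\gamma^jx_j\gamma^i+\tfrac12x^jx_j\partial^i$ lies in $N$; the raising operator $\widehat{x^i}\in Z_n$ is its class: $$\widehat{x^i}=(H+1)x^i+\tfrac12\gamma^jx_j\gamma^i+\tfrac12x^jx_j\partial^i+I .$$ Then for all $m,r\ge 0$, all $i_1,\dots,i_m\in\{1,\dots,n\}$ and all $1\le\alpha_1\le\dots\le\alpha_r\le n$, the Clifford monomial $p=\gamma^{\alpha_1}\cdots\gamma^{\alpha_r}$, viewed as a constant element of $V^+$, satisfies $$\widehat{x^{i_1}}\cdots\widehat{x^{i_m}}\cdot p=\bigl(\widehat{x^{i_1}}\cdots\widehat{x^{i_m}}\cdot 1\bigr)\,p ,$$ where the product on the right is taken in the algebra $V=\mathbb C[x^1,\dots,x^n]\otimes\mathrm{Cl}(\eta)$.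 -/

import Mathlib

open scoped TensorProduct

noncomputable section

namespace DiracReduction

/-! ### Consequences of the relations of the Weyl-Clifford algebra -/

/-- The relations of the Weyl-Clifford algebra for elements `x i`, `d i`, `g i` of an algebra. -/
structure Rels {n : ℕ} (η : Matrix (Fin n) (Fin n) ℂ) {B : Type*} [Ring B] [Algebra ℂ B]
    (x d g : Fin n → B) : Prop where
  xx : ∀ i j, x i * x j = x j * x i
  dd : ∀ i j, d i * d j = d j * d i
  dx : ∀ i j, d i * x j = x j * d i + if i = j then 1 else 0
  gx : ∀ i j, g i * x j = x j * g i
  gd : ∀ i j, g i * d j = d j * g i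
  gg : ∀ i j, g i * g j + g j * g i = (η i j + η j i) • 1

namespace Rels

variable {n : ℕ} {η : Matrix (Fin n) (Fin n) ℂ} {B : Type*} [Ring B] [Algebra ℂ B]
  {x d g : Fin n → B}

theorem dirac_x (h : Rels η x d g) (i : Fin n) :
    (∑ a, g a * d a) * x i = x i * (∑ a, g a * d a) + g i := by
  have : ∀ a, g a * d a * x i = x i * (g a * d a) + if a = i then g a else 0 := by
    intro a
    rw [mul_assoc, h.dx, mul_add, ← mul_assoc, h.gx, mul_assoc]
    split_ifs <;> simp
  simp [Finset.sum_mul, Finset.mul_sum, this, Finset.sum_add_distrib]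

theorem dirac_g (h : Rels η x d g) (hs : η.IsSymm) (i : Fin n) :
    (∑ a, g a * d a) * g i = -(g i * (∑ a, g a * d a)) + (2 : ℂ) • ∑ j, η i j • d j := by
  have : ∀ a, g a * d a * g i = -(g i * (g a * d a)) + (2 : ℂ) • η i a • d a := by
    intro a
    have e : g a * g i = -(g i * g a) + (η a i + η i a) • 1 := by
      rw [← h.gg]; abel
    rw [mul_assoc, ← h.gd, ← mul_assoc, e, hs.apply]
    rw [add_mul, smul_mul_assoc, one_mul, ← two_mul, mul_smul, neg_mul, mul_assoc]
  simp only [Finset.sum_mul, Finset.mul_sum, this, Finset.sum_add_distrib, Finset.sum_neg_distrib,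
    Finset.smul_sum]

/-- The Cartan element in normal order. -/
theorem cartan_eq (h : Rels η x d g) :
    (-(1 / 2) : ℂ) • ∑ i, (d i * x i + x i * d i)
      = -(∑ i, x i * d i) - ((n : ℂ) / 2) • (1 : B) := by
  have : ∀ i, d i * x i + x i * d i = (2 : ℂ) • (x i * d i) + 1 := by
    intro i
    rw [h.dx, if_pos rfl, two_smul]; abel
  simp only [this, Finset.sum_add_distrib, ← Finset.smul_sum]
  simp only [Finset.sum_const, Finset.card_univ, Fintype.card_fin, ← Nat.cast_smul_eq_nsmul ℂ n]
  module

theorem dirac_euler (h : Rels η x d g) :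
    (∑ a, g a * d a) * (∑ i, x i * d i)
      = (∑ i, x i * d i) * (∑ a, g a * d a) + ∑ a, g a * d a := by
  have : ∀ i, (∑ a, g a * d a) * (x i * d i) = x i * d i * (∑ a, g a * d a) + g i * d i := by
    intro i
    have e : (∑ a, g a * d a) * d i = d i * (∑ a, g a * d a) := by
      simp only [Finset.sum_mul, Finset.mul_sum]
      refine Finset.sum_congr rfl fun a _ => ?_
      rw [mul_assoc, h.dd, ← mul_assoc, h.gd, mul_assoc]
    rw [← mul_assoc, h.dirac_x, add_mul, mul_assoc, e, mul_assoc]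
  rw [Finset.mul_sum]
  simp only [this, Finset.sum_add_distrib, Finset.sum_mul]

theorem d_xl (h : Rels η x d g) (a j : Fin n) :
    d a * (∑ k, η⁻¹ j k • x k) = (∑ k, η⁻¹ j k • x k) * d a + η⁻¹ j a • 1 := by
  simp [Finset.mul_sum, Finset.sum_mul, h.dx, smul_add, Finset.sum_add_distrib]

theorem g_xl (h : Rels η x d g) (a j : Fin n) :
    g a * (∑ k, η⁻¹ j k • x k) = (∑ k, η⁻¹ j k • x k) * g a := by
  simp [Finset.mul_sum, Finset.sum_mul, h.gx]

theorem raise_lower (hd : IsUnit η.det) (a : Fin n) :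
    ∑ j, η a j • (∑ k, η⁻¹ j k • x k) = x a := by
  simp only [Finset.smul_sum, smul_smul]
  rw [Finset.sum_comm]
  simp only [← Finset.sum_smul, ← Matrix.mul_apply, Matrix.mul_nonsing_inv _ hd]
  simp [Matrix.one_apply]

theorem dirac_y (h : Rels η x d g) (hs : η.IsSymm) (hd : IsUnit η.det) :
    (∑ a, g a * d a) * (∑ j, g j * ∑ k, η⁻¹ j k • x k)
      = -((∑ j, g j * ∑ k, η⁻¹ j k • x k) * (∑ a, g a * d a))
        + (2 : ℂ) • (∑ i, x i * d i) + (n : ℂ) • 1 := by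
  have hs' : ∀ i j, η⁻¹ i j = η⁻¹ j i := fun i j => by
    have : (η⁻¹).transpose = η⁻¹ := by rw [Matrix.transpose_nonsing_inv, hs.eq]
    conv_lhs => rw [← this]
    rfl
  have e1 : ∀ a j, g a * d a * (g j * ∑ k, η⁻¹ j k • x k)
      = -((g j * ∑ k, η⁻¹ j k • x k) * (g a * d a))
        + ((2 : ℂ) • (η a j • ∑ k, η⁻¹ j k • x k) * d a + η⁻¹ j a • (g a * g j)) := by
    intro a j
    have e : g a * g j = -(g j * g a) + (η a j + η j a) • 1 := by
      rw [← h.gg]; abel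
    have t1 : g a * d a * (g j * ∑ k, η⁻¹ j k • x k)
        = g a * g j * (∑ k, η⁻¹ j k • x k) * d a + η⁻¹ j a • (g a * g j) := by
      rw [mul_assoc, ← mul_assoc (d a), ← h.gd, mul_assoc (g j), h.d_xl]
      simp only [mul_add, mul_assoc, mul_smul_comm, mul_one]
    have t2 : g j * (∑ k, η⁻¹ j k • x k) * (g a * d a)
        = g j * g a * (∑ k, η⁻¹ j k • x k) * d a := by
      rw [mul_assoc, ← mul_assoc _ (g a), ← h.g_xl]
      simp only [mul_assoc]
    rw [t1, t2]
    rw [← add_assoc]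
    congr 1
    rw [e, hs.apply a j, ← two_mul]
    simp only [add_mul, neg_mul, smul_mul_assoc, one_mul, mul_smul]
  have e2 : ∑ a, ∑ j, η⁻¹ j a • (g a * g j) = (n : ℂ) • (1 : B) := by
    have hsw : ∑ a, ∑ j, η⁻¹ j a • (g a * g j) = ∑ a, ∑ j, η⁻¹ j a • (g j * g a) := by
      rw [Finset.sum_comm]
      exact Finset.sum_congr rfl fun a _ => Finset.sum_congr rfl fun j _ => by rw [hs']
    have hd2 : (2 : ℂ) • ∑ a, ∑ j, η⁻¹ j a • (g a * g j) = (2 : ℂ) • (n : ℂ) • (1 : B) := by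
      rw [two_smul]
      nth_rewrite 2 [hsw]
      simp only [← Finset.sum_add_distrib, ← smul_add, h.gg, smul_smul]
      have : ∀ a, ∑ j, (η⁻¹ j a * (η a j + η j a)) • (1 : B) = (2 : ℂ) • 1 := by
        intro a
        rw [← Finset.sum_smul]
        congr 1
        have h1 : (η * η⁻¹) a a = 1 := by rw [Matrix.mul_nonsing_inv _ hd, Matrix.one_apply_eq]
        rw [Matrix.mul_apply] at h1
        calc ∑ j, η⁻¹ j a * (η a j + η j a) = ∑ j, 2 * (η a j * η⁻¹ j a) :=
              Finset.sum_congr rfl fun j _ => by rw [hs.apply a j]; ring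
          _ = 2 := by rw [← Finset.mul_sum, h1, mul_one]
      simp only [this, Finset.sum_const, Finset.card_univ, Fintype.card_fin,
        ← Nat.cast_smul_eq_nsmul ℂ n, smul_smul]
      rw [mul_comm]
    exact smul_right_injective B (two_ne_zero (α := ℂ)) hd2
  have e3 : ∑ a, ∑ j, (2 : ℂ) • (η a j • ∑ k, η⁻¹ j k • x k) * d a
      = (2 : ℂ) • ∑ i, x i * d i := by
    simp only [smul_mul_assoc, ← Finset.smul_sum]
    congr 1
    refine Finset.sum_congr rfl fun a _ => ?_
    conv_rhs => rw [← raise_lower (x := x) hd a, Finset.sum_mul]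
    simp only [smul_mul_assoc]
  have e4 : ∑ a, ∑ j, -((g j * ∑ k, η⁻¹ j k • x k) * (g a * d a))
      = -((∑ j, g j * ∑ k, η⁻¹ j k • x k) * (∑ a, g a * d a)) := by
    simp only [Finset.sum_neg_distrib, ← Finset.sum_mul, ← Finset.mul_sum]
  calc (∑ a, g a * d a) * (∑ j, g j * ∑ k, η⁻¹ j k • x k)
      = ∑ a, ∑ j, g a * d a * (g j * ∑ k, η⁻¹ j k • x k) := Finset.sum_mul_sum _ _ _ _
    _ = ∑ a, ∑ j, (-((g j * ∑ k, η⁻¹ j k • x k) * (g a * d a))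
        + ((2 : ℂ) • (η a j • ∑ k, η⁻¹ j k • x k) * d a + η⁻¹ j a • (g a * g j))) :=
        Finset.sum_congr rfl fun a _ => Finset.sum_congr rfl fun j _ => e1 a j
    _ = _ := by
        simp only [Finset.sum_add_distrib]
        rw [e2, e3, e4, add_assoc]

theorem dirac_r (h : Rels η x d g) (hs : η.IsSymm) :
    (∑ a, g a * d a) * (∑ j, x j * ∑ k, η⁻¹ j k • x k)
      = (∑ j, x j * ∑ k, η⁻¹ j k • x k) * (∑ a, g a * d a)
        + (2 : ℂ) • ∑ j, g j * ∑ k, η⁻¹ j k • x k := by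
  have hs' : ∀ i j, η⁻¹ i j = η⁻¹ j i := fun i j => by
    have : (η⁻¹).transpose = η⁻¹ := by rw [Matrix.transpose_nonsing_inv, hs.eq]
    conv_lhs => rw [← this]
    rfl
  have e0 : ∀ j, (∑ a, g a * d a) * (∑ k, η⁻¹ j k • x k)
      = (∑ k, η⁻¹ j k • x k) * (∑ a, g a * d a) + ∑ k, η⁻¹ j k • g k := by
    intro j
    simp only [Finset.mul_sum (Finset.univ) (fun k => η⁻¹ j k • x k), mul_smul_comm, h.dirac_x,
      smul_add, Finset.sum_add_distrib]
    rw [Finset.sum_mul]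
    simp only [smul_mul_assoc]
  have e1 : ∀ j, (∑ a, g a * d a) * (x j * ∑ k, η⁻¹ j k • x k)
      = x j * (∑ k, η⁻¹ j k • x k) * (∑ a, g a * d a)
        + (x j * (∑ k, η⁻¹ j k • g k) + g j * ∑ k, η⁻¹ j k • x k) := by
    intro j
    rw [← mul_assoc, h.dirac_x, add_mul, mul_assoc, e0, mul_add, ← mul_assoc, add_assoc]
  have e2 : ∑ j, x j * (∑ k, η⁻¹ j k • g k) = ∑ j, g j * ∑ k, η⁻¹ j k • x k := by
    simp only [Finset.mul_sum]
    rw [Finset.sum_comm]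
    refine Finset.sum_congr rfl fun j _ => Finset.sum_congr rfl fun k _ => ?_
    rw [mul_smul_comm, mul_smul_comm, hs', h.gx]
  rw [Finset.mul_sum]
  simp only [e1, Finset.sum_add_distrib, e2]
  rw [Finset.sum_mul, two_smul]

/-- Up to elements of the left ideal generated by the Dirac operator, the Dirac operator commutes
with the representative of the raising operator. -/
theorem dirac_raising (h : Rels η x d g) (hs : η.IsSymm) (hd : IsUnit η.det) (i : Fin n) :
    ∃ b : B, (∑ a, g a * d a) *
      (((-(1 / 2) : ℂ) • ∑ i, (d i * x i + x i * d i) + 1) * x i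
        + (1 / 2 : ℂ) • ∑ j, g j * (∑ k, η⁻¹ j k • x k) * g i
        + (1 / 2 : ℂ) • ∑ j, x j * (∑ k, η⁻¹ j k • x k) * ∑ k, η i k • d k)
      = b * ∑ a, g a * d a := by
  rw [h.cartan_eq, ← Finset.sum_mul, ← Finset.sum_mul]
  have hdu : (∑ a, g a * d a) * (∑ k, η i k • d k) = (∑ k, η i k • d k) * ∑ a, g a * d a := by
    simp only [Finset.sum_mul, Finset.mul_sum]
    rw [Finset.sum_comm]
    refine Finset.sum_congr rfl fun a _ => Finset.sum_congr rfl fun j _ => ?_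
    rw [mul_smul_comm, smul_mul_assoc, mul_assoc, h.dd, ← mul_assoc, h.gd, mul_assoc]
  have h1 := h.dirac_x i
  have h2 := h.dirac_g hs i
  have h3 := h.dirac_euler
  have h4 := h.dirac_y hs hd
  have h5 := h.dirac_r hs
  generalize (∑ a, g a * d a) = D at *
  generalize (∑ k, η i k • d k) = T at *
  generalize (∑ i, x i * d i) = N at *
  generalize (∑ j, g j * ∑ k, η⁻¹ j k • x k) = Y at *
  generalize (∑ j, x j * ∑ k, η⁻¹ j k • x k) = R at *
  have a1 : D * ((-N - ((n : ℂ) / 2) • (1 : B) + 1) * x i)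
      = (-N - ((n : ℂ) / 2) • (1 : B)) * (x i * D) + (-N - ((n : ℂ) / 2) • (1 : B)) * g i := by
    rw [← mul_add, ← h1, ← mul_assoc, ← mul_assoc]
    congr 1
    simp only [mul_add, mul_sub, mul_neg, h3, sub_mul, neg_mul, smul_mul_assoc, mul_smul_comm,
      one_mul, mul_one]
    abel
  have a2 : D * (Y * g i) = Y * (g i * D) - (2 : ℂ) • (Y * T) + (2 : ℂ) • (N * g i)
      + (n : ℂ) • g i := by
    rw [← mul_assoc, h4]
    simp only [add_mul, neg_mul, mul_assoc, h2, smul_mul_assoc, one_mul, mul_add, mul_neg,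
      mul_smul_comm]
    abel
  have a3 : D * (R * T) = R * (T * D) + (2 : ℂ) • (Y * T) := by
    rw [← mul_assoc, h5, add_mul, mul_assoc, hdu, smul_mul_assoc]
  refine ⟨(-N - ((n : ℂ) / 2) • (1 : B)) * x i + (1 / 2 : ℂ) • (Y * g i)
    + (1 / 2 : ℂ) • (R * T), ?_⟩
  simp only [mul_add D, mul_smul_comm, a1, a2, a3]
  simp only [add_mul, sub_mul, neg_mul, smul_mul_assoc, one_mul, mul_assoc]
  module

theorem dirac_sq (h : Rels η x d g) :
    (∑ a, g a * d a) * (∑ a, g a * d a) = ∑ i, (∑ j, η i j • d j) * d i := by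
  have e1 : (∑ a, g a * d a) * (∑ a, g a * d a) = ∑ a, ∑ b, g a * g b * (d a * d b) := by
    rw [Finset.sum_mul_sum]
    refine Finset.sum_congr rfl fun a _ => Finset.sum_congr rfl fun b _ => ?_
    rw [mul_assoc, ← mul_assoc (d a), ← h.gd, mul_assoc, ← mul_assoc]
  have e2 : ∑ a, ∑ b, g a * g b * (d a * d b) = ∑ a, ∑ b, g b * g a * (d a * d b) := by
    rw [Finset.sum_comm]
    exact Finset.sum_congr rfl fun a _ => Finset.sum_congr rfl fun b _ => by rw [h.dd]
  have e3 : ∑ i, (∑ j, η i j • d j) * d i = ∑ a, ∑ b, η a b • (d a * d b) := by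
    simp only [Finset.sum_mul, smul_mul_assoc]
    exact Finset.sum_congr rfl fun a _ => Finset.sum_congr rfl fun b _ => by rw [h.dd]
  have e4 : ∑ a, ∑ b, η b a • (d a * d b) = ∑ a, ∑ b, η a b • (d a * d b) := by
    rw [Finset.sum_comm]
    exact Finset.sum_congr rfl fun a _ => Finset.sum_congr rfl fun b _ => by rw [h.dd]
  apply smul_right_injective B (two_ne_zero (α := ℂ))
  simp only
  rw [two_smul, two_smul]
  conv_lhs => rw [e1]
  nth_rewrite 2 [e2]
  rw [e3]
  nth_rewrite 2 [← e4]
  simp only [← Finset.sum_add_distrib, ← add_mul, h.gg, smul_mul_assoc, one_mul, ← add_smul]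

end Rels

/-! ### The Weyl algebra -/

/-- Generators of the Weyl algebra: coordinates `x^i` and partial derivatives `∂_i`. -/
inductive WeylGen (n : ℕ) : Type
  | x (i : Fin n) : WeylGen n
  | d (i : Fin n) : WeylGen n

/-- Defining relations of the Weyl algebra with `2n` generators. -/
inductive WeylRel (n : ℕ) : FreeAlgebra ℂ (WeylGen n) → FreeAlgebra ℂ (WeylGen n) → Prop
  | x_comm (i j : Fin n) :
      WeylRel n (FreeAlgebra.ι ℂ (.x i) * FreeAlgebra.ι ℂ (.x j))
        (FreeAlgebra.ι ℂ (.x j) * FreeAlgebra.ι ℂ (.x i))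
  | d_comm (i j : Fin n) :
      WeylRel n (FreeAlgebra.ι ℂ (.d i) * FreeAlgebra.ι ℂ (.d j))
        (FreeAlgebra.ι ℂ (.d j) * FreeAlgebra.ι ℂ (.d i))
  | d_x (i j : Fin n) :
      WeylRel n (FreeAlgebra.ι ℂ (.d i) * FreeAlgebra.ι ℂ (.x j))
        (FreeAlgebra.ι ℂ (.x j) * FreeAlgebra.ι ℂ (.d i) + if i = j then 1 else 0)

/-- The Weyl algebra `W(2n)` over `ℂ`. -/
def WeylAlgebra (n : ℕ) : Type := RingQuot (WeylRel n)

instance (n : ℕ) : Ring (WeylAlgebra n) := inferInstanceAs (Ring (RingQuot (WeylRel n)))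

instance (n : ℕ) : Algebra ℂ (WeylAlgebra n) :=
  inferInstanceAs (Algebra ℂ (RingQuot (WeylRel n)))

namespace WeylAlgebra

variable {n : ℕ}

/-- The quotient map from the free algebra to the Weyl algebra. -/
def mk (n : ℕ) : FreeAlgebra ℂ (WeylGen n) →ₐ[ℂ] WeylAlgebra n :=
  RingQuot.mkAlgHom ℂ (WeylRel n)

theorem mk_rel {a b : FreeAlgebra ℂ (WeylGen n)} (h : WeylRel n a b) : mk n a = mk n b :=
  RingQuot.mkAlgHom_rel ℂ h

/-- The image of a generator in the Weyl algebra. -/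
def gen (g : WeylGen n) : WeylAlgebra n := mk n (FreeAlgebra.ι ℂ g)

theorem x_comm (i j : Fin n) : gen (.x i) * gen (.x j) = gen (.x j) * gen (.x i) := by
  simpa [gen] using mk_rel (WeylRel.x_comm i j)

theorem d_comm (i j : Fin n) : gen (.d i) * gen (.d j) = gen (.d j) * gen (.d i) := by
  simpa [gen] using mk_rel (WeylRel.d_comm i j)

theorem d_x (i j : Fin n) :
    gen (.d i) * gen (.x j) = gen (.x j) * gen (.d i) + if i = j then 1 else 0 := by
  have h := mk_rel (WeylRel.d_x i j)
  split_ifs at h ⊢ <;> simpa [gen] using h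

/-- The operators on `ℂ[x^1,…,x^n]` by which the generators act: `x^i` by multiplication,
`∂_i` by partial differentiation. -/
def genAction : WeylGen n → Module.End ℂ (MvPolynomial (Fin n) ℂ)
  | .x i => LinearMap.mulLeft ℂ (MvPolynomial.X i)
  | .d i => (MvPolynomial.pderiv i).toLinearMap

theorem genAction_rel ⦃a b : FreeAlgebra ℂ (WeylGen n)⦄ (h : WeylRel n a b) :
    FreeAlgebra.lift ℂ genAction a = FreeAlgebra.lift ℂ genAction b := by
  induction h with
  | x_comm i j =>
    refine LinearMap.ext fun f => ?_
    simp [genAction, mul_left_comm]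
  | d_comm i j =>
    have h : ⁅MvPolynomial.pderiv (R := ℂ) i, MvPolynomial.pderiv (R := ℂ) j⁆ = 0 := by
      apply MvPolynomial.derivation_ext
      intro k
      simp [Derivation.commutator_apply, MvPolynomial.pderiv_X, Pi.single_apply, apply_ite]
    refine LinearMap.ext fun f => ?_
    have h2 := congrArg (fun D => D f) h
    simp only [Derivation.commutator_apply, Derivation.zero_apply, sub_eq_zero] at h2
    simpa [genAction] using h2
  | d_x i j =>
    refine LinearMap.ext fun f => ?_
    by_cases hij : i = j
    · subst hij
      simp [genAction, Derivation.leibniz]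
    · simp [genAction, hij, Derivation.leibniz, MvPolynomial.pderiv_X_of_ne (Ne.symm hij)]

/-- The action of the Weyl algebra on polynomials by differential operators. -/
def action (n : ℕ) : WeylAlgebra n →ₐ[ℂ] Module.End ℂ (MvPolynomial (Fin n) ℂ) :=
  RingQuot.liftAlgHom ℂ ⟨FreeAlgebra.lift ℂ genAction, genAction_rel⟩

theorem action_gen (g : WeylGen n) : action n (gen g) = genAction g :=
  (RingQuot.liftAlgHom_mkAlgHom_apply ℂ (FreeAlgebra.lift ℂ genAction) genAction_rel _).trans
    (FreeAlgebra.lift_ι_apply genAction g)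

end WeylAlgebra

/-! ### The Weyl-Clifford algebra -/

section

variable {n : ℕ} (η : Matrix (Fin n) (Fin n) ℂ)

/-- The complex Clifford algebra of the quadratic form `v ↦ ∑ i j, η^{ij} v_i v_j`. -/
abbrev Cl : Type := CliffordAlgebra η.toQuadraticForm'

/-- The Clifford generator `γ^i` as an element of the Clifford algebra. -/
def cliffGen (i : Fin n) : Cl η := CliffordAlgebra.ι η.toQuadraticForm' (Pi.single i 1)

theorem cliffGen_mul_add (i j : Fin n) :
    cliffGen η i * cliffGen η j + cliffGen η j * cliffGen η i
      = algebraMap ℂ (Cl η) (η i j + η j i) := by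
  rw [cliffGen, cliffGen, CliffordAlgebra.ι_mul_ι_add_swap]
  have h := LinearMap.BilinMap.polar_toQuadraticMap
    (B := (Matrix.toLinearMap₂' ℂ η : LinearMap.BilinMap ℂ (Fin n → ℂ) ℂ)) (Pi.single i 1) (Pi.single j 1)
  have e : ∀ i j, (Matrix.toLinearMap₂' ℂ η : LinearMap.BilinMap ℂ (Fin n → ℂ) ℂ)
      (Pi.single i 1) (Pi.single j 1) = η i j :=
    fun i j => by rw [Matrix.toLinearMap₂'_apply']; simp
  rw [e, e] at h
  have h2 : QuadraticMap.polar η.toQuadraticForm' (Pi.single i 1) (Pi.single j 1)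
      = η i j + η j i := h
  rw [h2]

/-- The Weyl-Clifford algebra `W(2n|n) = W(2n) ⊗ Cl(η)`. -/
def WeylClifford : Type := WeylAlgebra n ⊗[ℂ] Cl η

instance : Ring (WeylClifford η) := inferInstanceAs (Ring (WeylAlgebra n ⊗[ℂ] Cl η))

instance : Algebra ℂ (WeylClifford η) := inferInstanceAs (Algebra ℂ (WeylAlgebra n ⊗[ℂ] Cl η))

/-- The embedding of the Weyl algebra in the Weyl-Clifford algebra. -/
def ofWeyl : WeylAlgebra n →ₐ[ℂ] WeylClifford η :=
  (Algebra.TensorProduct.includeLeft : WeylAlgebra n →ₐ[ℂ] WeylAlgebra n ⊗[ℂ] Cl η)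

/-- The embedding of the Clifford algebra in the Weyl-Clifford algebra. -/
def ofCl : Cl η →ₐ[ℂ] WeylClifford η :=
  (Algebra.TensorProduct.includeRight : Cl η →ₐ[ℂ] WeylAlgebra n ⊗[ℂ] Cl η)

theorem ofCl_comm (q : Cl η) (w : WeylAlgebra n) :
    ofCl η q * ofWeyl η w = ofWeyl η w * ofCl η q := by
  change ((1 : WeylAlgebra n) ⊗ₜ[ℂ] q) * (w ⊗ₜ[ℂ] (1 : Cl η))
    = (w ⊗ₜ[ℂ] (1 : Cl η)) * ((1 : WeylAlgebra n) ⊗ₜ[ℂ] q)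
  simp

/-- The element `x^i`. -/
def xUp (i : Fin n) : WeylClifford η := ofWeyl η (WeylAlgebra.gen (.x i))

/-- The element `∂_i`. -/
def dDown (i : Fin n) : WeylClifford η := ofWeyl η (WeylAlgebra.gen (.d i))

/-- The element `γ^i`. -/
def gam (i : Fin n) : WeylClifford η := ofCl η (cliffGen η i)

/-- `x_i = ∑_j η_{ij} x^j`, where `(η_{ij})` is the inverse matrix of `(η^{ij})`. -/
def xDown (i : Fin n) : WeylClifford η := ∑ j, η⁻¹ i j • xUp η j

/-- `∂^i = ∑_j η^{ij} ∂_j`. -/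
def dUp (i : Fin n) : WeylClifford η := ∑ j, η i j • dDown η j

/-- The Dirac operator `γ^a ∂_a`. -/
def dirac : WeylClifford η := ∑ a, gam η a * dDown η a

/-- The image `X` of the positive odd root vector of `osp(1|2)`. -/
def opX : WeylClifford η := (Complex.I / (Real.sqrt 2 : ℂ)) • dirac η

/-- The image `E` of the positive even root vector of `osp(1|2)`. -/
def opE : WeylClifford η := (-(1 / 2) : ℂ) • ∑ i, dUp η i * dDown η i

/-- The image `H` of the Cartan generator of `osp(1|2)`. -/
def opH : WeylClifford η := (-(1 / 2) : ℂ) • ∑ i, (dDown η i * xUp η i + xUp η i * dDown η i)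

/-- `𝔤₊ = ℂX ⊕ ℂE`. -/
def gPlus : Submodule ℂ (WeylClifford η) := Submodule.span ℂ {opX η, opE η}

/-- The left ideal generated by `𝔤₊` in the Weyl-Clifford algebra. -/
def leftIdeal : Ideal (WeylClifford η) := Ideal.span (gPlus η : Set (WeylClifford η))

end

/-! ### Reduction algebras -/

/-- The normalizer `N(J) = {a | J a ⊆ J}` of a left ideal `J`. -/
def normalizer {A : Type*} [Ring A] [Algebra ℂ A] (J : Ideal A) : Subalgebra ℂ A where
  carrier := {a | ∀ b ∈ J, b * a ∈ J}
  mul_mem' := by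
    intro a b ha hb c hc
    rw [← mul_assoc]
    exact hb _ (ha _ hc)
  add_mem' := by
    intro a b ha hb c hc
    rw [mul_add]
    exact J.add_mem (ha _ hc) (hb _ hc)
  algebraMap_mem' := by
    intro r b hb
    rw [← Algebra.commutes]
    exact J.mul_mem_left _ hb

/-- A left ideal `J`, viewed inside its normalizer (which contains it). -/
def idealInNormalizer {A : Type*} [Ring A] [Algebra ℂ A] (J : Ideal A) : Ideal (normalizer J) :=
  J.comap (normalizer J).subtype

instance {A : Type*} [Ring A] [Algebra ℂ A] (J : Ideal A) : (idealInNormalizer J).IsTwoSided :=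
  ⟨fun {a} b ha => by
    change ((a * b : normalizer J) : A) ∈ J
    exact b.2 _ ha⟩

/-- The reduction algebra `N(J)/J` of a left ideal `J`. -/
abbrev NormalizerQuotient {A : Type*} [Ring A] [Algebra ℂ A] (J : Ideal A) : Type _ :=
  normalizer J ⧸ idealInNormalizer J

section

variable {n : ℕ} (η : Matrix (Fin n) (Fin n) ℂ)

/-- The Dirac reduction algebra `Z_n = N(I)/I`. -/
abbrev ReductionAlgebra : Type := NormalizerQuotient (leftIdeal η)

/-! ### Clifford-valued polynomials and polynomial solutions of the Dirac equation -/

/-- The Clifford-valued polynomials `V = ℂ[x^1,…,x^n] ⊗ Cl(η)`, with its algebra structure. -/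
abbrev CliffordPoly : Type := MvPolynomial (Fin n) ℂ ⊗[ℂ] Cl η

/-- The action of the Weyl-Clifford algebra on Clifford-valued polynomials: `x^i` and `γ^i` act by
left multiplication, `∂_i` by partial differentiation. -/
def action : WeylClifford η →ₐ[ℂ] Module.End ℂ (CliffordPoly η) :=
  (Module.endTensorEndAlgHom.comp
    (Algebra.TensorProduct.map (WeylAlgebra.action n) (Algebra.lmul ℂ (Cl η))) :
      WeylAlgebra n ⊗[ℂ] Cl η →ₐ[ℂ] Module.End ℂ (CliffordPoly η))

theorem action_ofWeyl_tmul (w : WeylAlgebra n) (f : MvPolynomial (Fin n) ℂ) (q : Cl η) :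
    action η (ofWeyl η w) (f ⊗ₜ q) = WeylAlgebra.action n w f ⊗ₜ q := by
  change (Module.endTensorEndAlgHom (R := ℂ) (S := ℂ) (A := ℂ) (M := MvPolynomial (Fin n) ℂ)
    (N := Cl η) (Algebra.TensorProduct.map (WeylAlgebra.action n)
    (Algebra.lmul ℂ (Cl η)) (w ⊗ₜ 1))) (f ⊗ₜ q) = _
  simp only [Algebra.TensorProduct.map_tmul, Module.endTensorEndAlgHom_apply, map_one]
  simp

theorem action_ofCl_tmul (p : Cl η) (f : MvPolynomial (Fin n) ℂ) (q : Cl η) :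
    action η (ofCl η p) (f ⊗ₜ q) = f ⊗ₜ (p * q) := by
  change (Module.endTensorEndAlgHom (R := ℂ) (S := ℂ) (A := ℂ) (M := MvPolynomial (Fin n) ℂ)
    (N := Cl η) (Algebra.TensorProduct.map (WeylAlgebra.action n)
    (Algebra.lmul ℂ (Cl η)) (1 ⊗ₜ p))) (f ⊗ₜ q) = _
  simp only [Algebra.TensorProduct.map_tmul, Module.endTensorEndAlgHom_apply, map_one]
  simp

/-- The space `V⁺` of Clifford-valued polynomial solutions of the Dirac equation. -/
def solutions : Submodule ℂ (CliffordPoly η) := LinearMap.ker (action η (dirac η))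

/-! ### Relations in the Weyl-Clifford algebra -/

theorem xUp_comm (i j : Fin n) : xUp η i * xUp η j = xUp η j * xUp η i := by
  simp only [xUp, ← map_mul, WeylAlgebra.x_comm i j]

theorem dDown_comm (i j : Fin n) : dDown η i * dDown η j = dDown η j * dDown η i := by
  simp only [dDown, ← map_mul, WeylAlgebra.d_comm i j]

theorem dDown_xUp (i j : Fin n) :
    dDown η i * xUp η j = xUp η j * dDown η i + if i = j then 1 else 0 := by
  rw [dDown, xUp, ← map_mul, WeylAlgebra.d_x, map_add, map_mul]
  split_ifs <;> simp

theorem gam_xUp (i j : Fin n) : gam η i * xUp η j = xUp η j * gam η i := ofCl_comm η _ _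

theorem gam_dDown (i j : Fin n) : gam η i * dDown η j = dDown η j * gam η i := ofCl_comm η _ _

theorem gam_mul_add (i j : Fin n) :
    gam η i * gam η j + gam η j * gam η i = (η i j + η j i) • 1 := by
  rw [gam, gam, ← map_mul, ← map_mul, ← map_add, cliffGen_mul_add, AlgHom.commutes,
    Algebra.algebraMap_eq_smul_one]

theorem rels : Rels η (xUp η) (dDown η) (gam η) where
  xx := xUp_comm η
  dd := dDown_comm η
  dx := dDown_xUp η
  gx := gam_xUp η
  gd := gam_dDown η
  gg := gam_mul_add η

theorem opE_eq : opE η = opX η * opX η := by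
  have hc : (Complex.I / (Real.sqrt 2 : ℂ)) * (Complex.I / (Real.sqrt 2 : ℂ)) = -(1 / 2) := by
    rw [div_mul_div_comm, Complex.I_mul_I, ← Complex.ofReal_mul,
      Real.mul_self_sqrt (by norm_num)]
    norm_num
  rw [opX, smul_mul_smul_comm, hc, opE, dirac, (rels η).dirac_sq]
  rfl

theorem leftIdeal_eq : leftIdeal η = Ideal.span {dirac η} := by
  have hX : opX η ∈ Ideal.span {dirac η} := by
    refine Ideal.mem_span_singleton'.2 ⟨(Complex.I / (Real.sqrt 2 : ℂ)) • 1, ?_⟩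
    rw [opX, smul_mul_assoc, one_mul]
  apply le_antisymm
  · refine Ideal.span_le.2 fun a ha => ?_
    obtain ⟨s, t, rfl⟩ := Submodule.mem_span_pair.1 ha
    refine Ideal.add_mem _ ?_ ?_
    · rw [← one_mul (opX η), ← smul_mul_assoc]
      exact Ideal.mul_mem_left _ _ hX
    · rw [opE_eq, ← smul_mul_assoc]
      exact Ideal.mul_mem_left _ _ hX
  · refine Ideal.span_le.2 ?_
    rintro _ rfl
    have h : opX η ∈ leftIdeal η := Ideal.subset_span (Submodule.subset_span (by simp))
    have hc : (Complex.I / (Real.sqrt 2 : ℂ)) ≠ 0 := by simp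
    have e : dirac η = ((Complex.I / (Real.sqrt 2 : ℂ))⁻¹ • (1 : WeylClifford η)) * opX η := by
      rw [opX, smul_mul_smul_comm, inv_mul_cancel₀ hc, one_smul, one_mul]
    rw [e]
    exact Ideal.mul_mem_left _ _ h

theorem action_leftIdeal {a : WeylClifford η} (ha : a ∈ leftIdeal η) (v : solutions η) :
    action η a v = 0 := by
  rw [leftIdeal_eq] at ha
  obtain ⟨b, rfl⟩ := Ideal.mem_span_singleton'.1 ha
  rw [map_mul, Module.End.mul_apply, LinearMap.mem_ker.1 v.2, map_zero]

theorem action_normalizer {a : WeylClifford η} (ha : a ∈ normalizer (leftIdeal η))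
    {v : CliffordPoly η} (hv : v ∈ solutions η) : action η a v ∈ solutions η := by
  have h : dirac η * a ∈ leftIdeal η :=
    ha _ (by rw [leftIdeal_eq]; exact Ideal.mem_span_singleton_self _)
  have h2 := action_leftIdeal η h ⟨v, hv⟩
  rw [map_mul] at h2
  exact h2

/-- The action of the normalizer `N(I)` on solutions of the Dirac equation. -/
def normalizerAction :
    normalizer (leftIdeal η) →+* Module.End ℂ (solutions η) where
  toFun a := (action η a).restrict fun _ hv => action_normalizer η a.2 hv
  map_one' := by ext1 v; apply Subtype.ext; simp
  map_mul' a b := by ext1 v; apply Subtype.ext; simp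
  map_zero' := by ext1 v; apply Subtype.ext; simp
  map_add' a b := by ext1 v; apply Subtype.ext; simp

/-- The action of the reduction algebra `Z_n = N(I)/I` on the space `V⁺` of polynomial solutions of
the Dirac equation, induced by the action of the Weyl-Clifford algebra. -/
def reductionAction : ReductionAlgebra η →+* Module.End ℂ (solutions η) :=
  Ideal.Quotient.lift (idealInNormalizer (leftIdeal η)) (normalizerAction η) fun a ha => by
    ext1 v
    apply Subtype.ext
    exact action_leftIdeal η ha v

/-! ### Raising operators and Clifford monomials -/

/-- `(H+1) x^i + ½ γ^j x_j γ^i + ½ x^j x_j ∂^i`, the representative of the raising operator. -/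
def raisingRep (i : Fin n) : WeylClifford η :=
  (opH η + 1) * xUp η i
    + (1 / 2 : ℂ) • ∑ j, gam η j * xDown η j * gam η i
    + (1 / 2 : ℂ) • ∑ j, xUp η j * xDown η j * dUp η i

theorem raisingRep_mem (hs : η.IsSymm) (hd : IsUnit η.det) (i : Fin n) :
    raisingRep η i ∈ normalizer (leftIdeal η) := by
  obtain ⟨c, hc⟩ := (rels η).dirac_raising hs hd i
  intro b hb
  rw [leftIdeal_eq] at hb ⊢
  obtain ⟨b, rfl⟩ := Ideal.mem_span_singleton'.1 hb
  refine Ideal.mem_span_singleton'.2 ⟨b * c, ?_⟩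
  rw [mul_assoc, mul_assoc]
  exact congrArg _ hc.symm

/-- The raising operator `x̂^i` in the reduction algebra. -/
def raising (hs : η.IsSymm) (hd : IsUnit η.det) (i : Fin n) : ReductionAlgebra η :=
  Ideal.Quotient.mk (idealInNormalizer (leftIdeal η))
    ⟨raisingRep η i, raisingRep_mem η hs hd i⟩

/-- An element of the Clifford algebra viewed as a constant Clifford-valued polynomial. -/
def const (q : Cl η) : CliffordPoly η := 1 ⊗ₜ q

theorem const_mem (q : Cl η) : const η q ∈ solutions η := by
  rw [solutions, LinearMap.mem_ker, dirac, map_sum, LinearMap.sum_apply]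
  refine Finset.sum_eq_zero fun a _ => ?_
  rw [map_mul, Module.End.mul_apply]
  have : action η (dDown η a) (const η q) = 0 := by
    rw [dDown, const, action_ofWeyl_tmul, WeylAlgebra.action_gen]
    simp [WeylAlgebra.genAction]
  rw [this, map_zero]

/-- A constant Clifford-valued polynomial as a solution of the Dirac equation. -/
def constSol (q : Cl η) : solutions η := ⟨const η q, const_mem η q⟩

/-- The Clifford monomial `γ^{α_1} ⋯ γ^{α_r}`. -/
def cliffMonomial {r : ℕ} (α : Fin r → Fin n) : Cl η := (List.ofFn fun k => cliffGen η (α k)).prod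

end

end DiracReduction

end

open DiracReduction

/-!
Clifford-valued polynomials form a bimodule: the Weyl-Clifford algebra acts on the left, and the
Clifford algebra acts by right multiplication by constants. On a pure tensor `f ⊗ c` the left action
differentiates and multiplies `f` and multiplies `c` on the left, so by associativity of the
Clifford algebra it commutes with right multiplication by a constant (`action_mul_const`). Every
class in the reduction algebra acts through a representative in the Weyl-Clifford algebra, hence the
reduction algebra commutes with right multiplication as well (`reductionAction_mul_const`). The
theorem is the case of a product of raising operators applied to the constant `p = 1 * p`.
-/

namespace DiracReduction

variable {n : ℕ} (η : Matrix (Fin n) (Fin n) ℂ)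

/-- The Weyl-Clifford algebra acts by endomorphisms of the right `Cl η`-module `CliffordPoly η`. -/
theorem action_mul_const (a : WeylClifford η) (v : CliffordPoly η) (q : Cl η) :
    action η a (v * const η q) = action η a v * const η q := by
  have tmul (w : WeylAlgebra n) (p : Cl η) (f : MvPolynomial (Fin n) ℂ) (c : Cl η) :
      action η (w ⊗ₜ[ℂ] p : WeylAlgebra n ⊗[ℂ] Cl η) (f ⊗ₜ c)
        = WeylAlgebra.action n w f ⊗ₜ (p * c) := rfl
  induction v using TensorProduct.induction_on with
  | zero => simp
  | add v w hv hw => rw [add_mul, map_add, map_add, add_mul, hv, hw]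
  | tmul f c =>
    refine TensorProduct.induction_on
      (motive := fun a => action η a (f ⊗ₜ c * const η q) = action η a (f ⊗ₜ c) * const η q)
      a ?_ (fun w p => ?_) fun a b ha hb => ?_
    -- The motive is stated over the tensor product, to which `WeylClifford η` unfolds, so linearity
    -- of `action η` has to be restated there.
    · have h0 : action η (0 : WeylAlgebra n ⊗[ℂ] Cl η) = 0 := map_zero (action η)
      rw [h0, LinearMap.zero_apply, LinearMap.zero_apply, zero_mul]
    · simp only [const, Algebra.TensorProduct.tmul_mul_tmul, tmul, mul_one, mul_assoc]
    · have hadd : action η (a + b : WeylAlgebra n ⊗[ℂ] Cl η) = action η a + action η b :=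
        map_add (action η) a b
      rw [hadd, LinearMap.add_apply, LinearMap.add_apply, add_mul, ha, hb]

/-- The reduction algebra acts on solutions compatibly with right multiplication by constants. -/
theorem reductionAction_mul_const (z : ReductionAlgebra η) (p q : Cl η) :
    (reductionAction η z (constSol η (p * q)) : CliffordPoly η)
      = (reductionAction η z (constSol η p) : CliffordPoly η) * const η q := by
  obtain ⟨a, rfl⟩ := Ideal.Quotient.mk_surjective z
  have e : const η (p * q) = const η p * const η q := by simp [const]
  change action η a (const η (p * q)) = action η a (const η p) * const η q
  rw [e, action_mul_const]

end DiracReduction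

open DiracReduction
theorem mainTheorem6 {n : ℕ} (η : Matrix (Fin n) (Fin n) ℂ) (hs : η.IsSymm) (hd : IsUnit η.det)
    {m : ℕ} (i : Fin m → Fin n) {r : ℕ} (α : Fin r → Fin n) (hα : Monotone α) :
    (reductionAction η (List.ofFn fun k => raising η hs hd (i k)).prod
        (constSol η (cliffMonomial η α)) : CliffordPoly η)
      = (reductionAction η (List.ofFn fun k => raising η hs hd (i k)).prod
          (constSol η 1) : CliffordPoly η) * const η (cliffMonomial η α) := by
  rw [← reductionAction_mul_const, one_mul]
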